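/- Let $\mathbf X^0=\{x\in\mathbb R^n: g^0_j(x)\ge 0,\ j=1,\dots,m^0\}$ and $\mathbf X=\{x\in\mathbb R^n: g_j(x)\ge 0,\ j=1,\dots,m\}$ be compact sets defined by real polynomials, and let $f:\mathbb R^n\to\mathbb R^n$ be a polynomial map. Put $\mathbf X^{t}=\bigcup_{s=0}^{t} f^s(\mathbf X^0)$ and $\mathbf X^\infty=\bigcup_{t\ge 0}\mathbf X^t$, where $f^s$ is the $s$-fold composition of $f$, and $\mathbf Y^0=\mathbf X^0$, $\mathbf Y^t=f^t(\mathbf X^0)\setminus\mathbf X^{t-1}$ for $t\ge 1$. Assume that $\mathbf X^\infty\subseteq\mathbf X$ and that $\mathrm{vol}\,\mathbf X^\infty=\mathrm{vol}\,\overline{\mathbf X^\infty}$, where $\mathrm{vol}$ is Lebesgue measure. For a compact set $A$ let $\mathcal M_+(A)$ be the set of nonnegative finite Borel measures on $\mathbb R^n$ supported on $A$, and $\mathcal C(A)$ the space of continuous real functions on $A$; let $f_\#\nu$ be the image measure of $\nu$ under $f$, and $\lambda_{\mathbf X}$ the restriction of Lebesgue measure to $\mathbf X$. Fix an integer $T\ge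 1$. The primal LP is $$p^T=\sup\Big\{\mu(\mathbf X):\ \nu(\mathbf X)+a=T\,\mathrm{vol}\,\mathbf X,\ \ \mu+\nu=f_\#\nu+\mu_0,\ \ \mu+\hat\mu=\lambda_{\mathbf X},\ \ \mu_0\in\mathcal M_+(\mathbf X^0),\ \mu,\hat\mu,\nu\in\mathcal M_+(\mathbf X),\ a\in\mathbb R_{\ge 0}\Big\}$$ and the dual LP is to find the infimum $d^T$ of $\int_{\mathbf X}(w(x)+Tu)\,dx$ over all $u\in\mathbb R$ with $u\ge 0$ and all $v,w\in\mathcal C(\mathbf X)$ such that $v\ge 0$ on $\mathbf X^0$, $w\ge 1+v$ and $w\ge 0$ on $\mathbf X$, and $u+v(f(x))\ge v(x)$ for all $x\in\mathbf X$ with $f(x)\in\mathbf X$ (that is, for all $x\in\mathbf X$ if $f(\mathbf X)\subseteq\mathbf X$). Then there is no duality gap: $p^T=d^T$, and this value is finite. There exists a minimizing sequence for the dual LP, that is, a sequence of dual feasible points $(u_k,v_k,w_k)_{k\in\mathbb N}$ whose objective values converge to $d^T$. In addition, if some dual feasible point $(u,v,w)$ that attains $d^T$ has $u=0$, or, more generally,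 if some minimizing sequence $(u_k,v_k,w_k)_{k\in\mathbb N}$ of the dual LP has $u_k=0$ for infinitely many $k$, then $$\sum_{t=0}^{\infty} t\,\mathrm{vol}\,\mathbf Y^t<\infty\qquad\text{and}\qquad p^T=d^T=\mathrm{vol}\,\mathbf X^\infty .$$ -/

import Mathlib

open MeasureTheory Filter Topology
open scoped ENNReal

/-- The data of a discrete-time polynomial system on `ℝⁿ`: polynomials `g0` describing the set of
initial states, a polynomial transition map `f`, and polynomials `g` describing the ambient set. -/
structure PolySystem (n : ℕ) where
  m0 : ℕ
  g0 : Fin m0 → MvPolynomial (Fin n) ℝ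
  f : Fin n → MvPolynomial (Fin n) ℝ
  m : ℕ
  g : Fin m → MvPolynomial (Fin n) ℝ

namespace PolySystem

variable {n : ℕ} (S : PolySystem n)

/-- The set of initial states `X⁰ = {x : g0_j(x) ≥ 0 for all j}`. -/
def X0 : Set (Fin n → ℝ) := {x | ∀ j, 0 ≤ MvPolynomial.eval x (S.g0 j)}

/-- The ambient set `X = {x : g_j(x) ≥ 0 for all j}`. -/
def X : Set (Fin n → ℝ) := {x | ∀ j, 0 ≤ MvPolynomial.eval x (S.g j)}

/-- The transition map `x ↦ (f_1(x), …, f_n(x))`. -/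
noncomputable def step (x : Fin n → ℝ) : Fin n → ℝ := fun i => MvPolynomial.eval x (S.f i)

/-- `X^T`, the states reachable in at most `T` steps: the union of `f^t(X⁰)` over `t ≤ T`. -/
def reachUpTo (T : ℕ) : Set (Fin n → ℝ) := {x | ∃ t ≤ T, x ∈ S.step^[t] '' S.X0}

/-- `X^∞`, the reachable set: the increasing union of the sets `X^T`. -/
def reachSet : Set (Fin n → ℝ) := ⋃ T : ℕ, S.reachUpTo T

/-- `Y^t`, the states reached at time `t` and not before: `Y^0 = X⁰` and
`Y^t = f^t(X⁰) \ X^(t-1)` for `t ≥ 1`. -/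
def newStates : ℕ → Set (Fin n → ℝ)
  | 0 => S.X0
  | t + 1 => (S.step^[t + 1] '' S.X0) \ S.reachUpTo t

/-- The series `∑ t · vol Y^t` of nonnegative terms has a finite sum. -/
def FiniteSum : Prop := ∑' t : ℕ, (t : ℝ≥0∞) * volume (S.newStates t) < ⊤

/-- Nonnegative finite Borel measures on `ℝⁿ` that are supported on `A`
(for closed `A`, this is the same as giving mass zero to the complement of `A`). -/
def IsMeasureOn (A : Set (Fin n → ℝ)) (μ : Measure (Fin n → ℝ)) : Prop :=
  IsFiniteMeasure μ ∧ μ Aᶜ = 0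

/-- Feasibility of `(μ₀, μ, μ', ν, a)` for the primal linear program over measures. -/
structure IsPrimalFeasible (T : ℕ) (μ₀ μ μ' ν : Measure (Fin n → ℝ)) (a : ℝ) : Prop where
  init_mem : IsMeasureOn S.X0 μ₀
  mu_mem : IsMeasureOn S.X μ
  slack_mem : IsMeasureOn S.X μ'
  occ_mem : IsMeasureOn S.X ν
  a_nonneg : 0 ≤ a
  mass : ν.real S.X + a = T * volume.real S.X
  liouville : μ + ν = ν.map S.step + μ₀
  domination : μ + μ' = volume.restrict S.X

/-- `p^T`, the supremum of the mass of `μ` over all feasible points, in the extended reals. -/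
noncomputable def primalValue (T : ℕ) : EReal :=
  sSup {r : EReal | ∃ (μ₀ μ μ' ν : Measure (Fin n → ℝ)) (a : ℝ),
    S.IsPrimalFeasible T μ₀ μ μ' ν a ∧ r = ((μ.real S.X : ℝ) : EReal)}

/-- Feasibility of `(u, v, w)` for the dual linear program over continuous functions on `X`.
The constraint `u + v(f(x)) ≥ v(x)` is imposed at the points `x ∈ X` where `v(f(x))` is defined,
that is where `f(x) ∈ X`; these are all the points of `X` if `f(X) ⊆ X`. -/
structure IsDualFeasible (u : ℝ) (v w : C(S.X, ℝ)) : Prop where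
  init : ∀ x : S.X, (x : Fin n → ℝ) ∈ S.X0 → 0 ≤ v x
  dominate : ∀ x : S.X, 1 + v x ≤ w x
  w_nonneg : ∀ x : S.X, 0 ≤ w x
  decrease : ∀ (x : S.X) (hx : S.step x ∈ S.X), v x ≤ u + v ⟨S.step x, hx⟩
  u_nonneg : 0 ≤ u

/-- The dual objective `∫_X (w(x) + T u) dx`. -/
noncomputable def dualObjective (T : ℕ) (u : ℝ) (w : C(S.X, ℝ)) : ℝ :=
  ∫ x : S.X, (w x + T * u) ∂(volume.comap Subtype.val)

/-- `d^T`, the infimum of the dual objective over all feasible points, in the extended reals. -/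
noncomputable def dualValue (T : ℕ) : EReal :=
  sInf {r : EReal | ∃ (u : ℝ) (v w : C(S.X, ℝ)),
    S.IsDualFeasible u v w ∧ r = ((S.dualObjective T u w : ℝ) : EReal)}

/-- A dual feasible point that attains the infimum `d^T`. -/
def IsDualMinimizer (T : ℕ) (u : ℝ) (v w : C(S.X, ℝ)) : Prop :=
  S.IsDualFeasible u v w ∧ ((S.dualObjective T u w : ℝ) : EReal) = S.dualValue T

/-- A sequence of dual feasible points whose objective values converge to `d^T`. -/
def IsDualMinimizingSeq (T : ℕ) (u : ℕ → ℝ) (v w : ℕ → C(S.X, ℝ)) : Prop :=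
  (∀ k, S.IsDualFeasible (u k) (v k) (w k)) ∧
    Tendsto (fun k => ((S.dualObjective T (u k) (w k) : ℝ) : EReal)) atTop (𝓝 (S.dualValue T))

end PolySystem

/-! Weak duality is integration of the dual inequalities against a primal feasible point. Strong
duality comes from extending a positive functional: the dual constraints form a linear map into a
product of spaces of continuous functions whose range lies cofinally above everything (a Slater
condition), so the objective minus the optimal value factors through it as a positive functional
(`exists_nonneg_comp_eq`). By Riesz–Markov its components are measures, and they form a primal point
whose value equals the dual infimum. The primal optimum is therefore attained.

This optimal μ carries the last claim. If B misses X⁰, the equation μ + ν = f_#ν + μ₀ gives μ(B) +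
ν(B) = ν(f⁻¹B). For B the complement of the forward-invariant closure of X^∞ this forces μ(B) = 0,
so the mass of μ is at most vol X^∞. If u = 0, then v ≥ 0 along orbits from X⁰, so w ≥ 1 on X^∞ and
the dual objective is at least vol X^∞. Hence both values equal vol X^∞. For B the complement of X^t
the same identity telescopes, so ∑ μ(B) ≤ ν(ℝⁿ) < ∞; since μ is dominated by Lebesgue measure and
has full mass, this bounds ∑ t · vol Y^t. -/

/-! ### Positive functionals and their representation -/

/-- A generalized Farkas lemma: a linear functional `L` that is nonnegative wherever `A` is
nonnegative factors through `A` as a positive functional, provided that the range of `A`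
contains points above any given point. -/
theorem exists_nonneg_comp_eq {V E : Type*} [AddCommGroup V] [Module ℝ V] [AddCommGroup E]
    [PartialOrder E] [IsOrderedAddMonoid E] [Module ℝ E] [PosSMulMono ℝ E]
    (A : V →ₗ[ℝ] E) (L : V →ₗ[ℝ] ℝ)
    (hL : ∀ z, 0 ≤ A z → 0 ≤ L z) (hA : ∀ e, ∃ z, e ≤ A z) :
    ∃ φ : E →ₗ[ℝ] ℝ, (∀ e, 0 ≤ e → 0 ≤ φ e) ∧ ∀ z, φ (A z) = L z := by
  let B : V × E →ₗ[ℝ] E := A.coprod LinearMap.id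
  let p : Submodule ℝ (V × E) := LinearMap.ker (LinearMap.snd ℝ V E)
  let F : (V × E) →ₗ.[ℝ] ℝ := ⟨p, (L.comp (LinearMap.fst ℝ V E)).comp p.subtype⟩
  -- The cone is {(z, e) : 0 ≤ A z + e}, and the functional (z, 0) ↦ L z on V × 0 is extended to g.
  -- The sought φ is e ↦ g (0, e).
  obtain ⟨g, hg, hpos⟩ := riesz_extension ((PointedCone.positive ℝ E).comap B) F
    (by
      rintro ⟨⟨z, e⟩, he⟩ hz
      have he' : e = 0 := he
      subst he'
      have : 0 ≤ A z := by simpa [B] using hz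
      exact hL z this)
    (by
      rintro ⟨z, e⟩
      obtain ⟨y, hy⟩ := hA (-(A z + e))
      refine ⟨⟨(y, 0), by simp [F, p]⟩, ?_⟩
      have : 0 ≤ A y + (A z + e) := by simpa [neg_le_iff_add_nonneg, add_assoc] using hy
      simpa [B, add_assoc] using this)
  have hgz : ∀ z, g (z, 0) = L z := fun z => hg ⟨(z, 0), by simp [F, p]⟩
  -- Both (z, -A z) and its negative lie in the cone, so g vanishes there and g (0, A z) = g (z, 0)
  -- = L z.
  have key : ∀ z, L z ≤ g (0, A z) ∧ 0 ≤ g (z, -A z) := by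
    have h1 : ∀ z, 0 ≤ g (z, -A z) := fun z => hpos _ (by simp [B])
    intro z
    refine ⟨?_, h1 z⟩
    have := h1 (-z)
    have e : ((-z, -A (-z)) : V × E) = (0, A z) - (z, 0) := by simp
    rw [e, map_sub, hgz] at this
    linarith
  refine ⟨g.comp (LinearMap.inr ℝ V E), fun e he => hpos _ (by simpa [B] using he), fun z => ?_⟩
  refine le_antisymm ?_ (key z).1
  have := (key (-z)).1
  have e : ((0, A (-z)) : V × E) = -(0, A z) := by simp
  rw [e, map_neg, map_neg] at this
  simpa using this

/-- The Riesz–Markov–Kakutani theorem for a compact subset of a space, with the representing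
measure regarded as a measure on the whole space. -/
theorem exists_measure_of_isCompact {Ω : Type*} [TopologicalSpace Ω] [T2Space Ω]
    [MeasurableSpace Ω] [BorelSpace Ω] {A : Set Ω} (hA : IsCompact A)
    (Λ : C(A, ℝ) →ₗ[ℝ] ℝ) (hΛ : ∀ f, 0 ≤ f → 0 ≤ Λ f) :
    ∃ μ : Measure Ω, IsFiniteMeasure μ ∧ μ Aᶜ = 0 ∧
      ∀ f : C(Ω, ℝ), ∫ x, f x ∂μ = Λ (f.restrict A) := by
  have : CompactSpace A := isCompact_iff_compactSpace.mp hA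
  let e := (CompactlySupportedContinuousMap.continuousMapEquiv (α := A) (β := ℝ))
  let Λ' : CompactlySupportedContinuousMap A ℝ →ₚ[ℝ] ℝ := PositiveLinearMap.mk₀
    { toFun := fun f => Λ (e.symm f)
      map_add' := fun f g => Λ.map_add (e.symm f) (e.symm g)
      map_smul' := fun c f => Λ.map_smul c (e.symm f) }
    (fun f hf => hΛ _ (fun x => hf x))
  have hme : MeasurableEmbedding (Subtype.val : A → Ω) :=
    MeasurableEmbedding.subtype_coe hA.measurableSet
  have : IsFiniteMeasure (RealRMK.rieszMeasure Λ') :=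
    ⟨isCompact_univ.measure_lt_top⟩
  refine ⟨(RealRMK.rieszMeasure Λ').map Subtype.val, inferInstance, ?_, fun f => ?_⟩
  · rw [hme.map_apply]
    simp
  · rw [hme.integral_map]
    exact RealRMK.integral_rieszMeasure Λ' (e (f.restrict A))

namespace PolySystem

variable {n : ℕ} (S : PolySystem n)

/-! ### Continuity, extension and the dual objective -/

theorem continuous_step : Continuous S.step :=
  continuous_pi fun i => MvPolynomial.continuous_eval (S.f i)

theorem isFiniteMeasure_comap (hX : IsCompact S.X) :
    IsFiniteMeasure (volume.comap (Subtype.val : S.X → Fin n → ℝ)) := by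
  refine ⟨?_⟩
  rw [(MeasurableEmbedding.subtype_coe hX.measurableSet).comap_apply]
  simpa using hX.measure_lt_top

theorem X0_subset_reachUpTo (t : ℕ) : S.X0 ⊆ S.reachUpTo t :=
  fun x hx => ⟨0, Nat.zero_le t, x, hx, rfl⟩

theorem reachUpTo_subset_reachSet (t : ℕ) : S.reachUpTo t ⊆ S.reachSet :=
  Set.subset_iUnion S.reachUpTo t

theorem X0_subset_reachSet : S.X0 ⊆ S.reachSet :=
  (S.X0_subset_reachUpTo 0).trans (S.reachUpTo_subset_reachSet 0)

/-- Every continuous function on `X` extends to a bounded continuous function on `ℝⁿ`. -/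
theorem exists_bounded_extension (hX : IsCompact S.X) (v : C(S.X, ℝ)) :
    ∃ V : BoundedContinuousFunction (Fin n → ℝ) ℝ, ∀ x : S.X, V x = v x := by
  have : CompactSpace S.X := isCompact_iff_compactSpace.mp hX
  obtain ⟨V, -, hV⟩ := BoundedContinuousFunction.exists_norm_eq_domRestrict_eq_of_closed
    (BoundedContinuousFunction.mkOfCompact v) hX.isClosed
  exact ⟨V, fun x => congrArg (fun g => g x) hV⟩

theorem integrable_dualObjective (hX : IsCompact S.X) (T : ℕ) (u : ℝ) (w : C(S.X, ℝ)) :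
    Integrable (fun x : S.X => w x + T * u) (volume.comap Subtype.val) := by
  have : CompactSpace S.X := isCompact_iff_compactSpace.mp hX
  have := S.isFiniteMeasure_comap hX
  exact (BoundedContinuousFunction.mkOfCompact
    (w + ContinuousMap.const S.X ((T : ℝ) * u))).integrable _

theorem dualObjective_combo (hX : IsCompact S.X) (T : ℕ) (a b u u' : ℝ) (w w' : C(S.X, ℝ)) :
    S.dualObjective T (a * u + b * u') (a • w + b • w') =
      a * S.dualObjective T u w + b * S.dualObjective T u' w' := by
  unfold dualObjective
  rw [← integral_const_mul, ← integral_const_mul, ← integral_add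
    ((S.integrable_dualObjective hX T u w).const_mul a)
    ((S.integrable_dualObjective hX T u' w').const_mul b)]
  refine integral_congr_ae (Eventually.of_forall fun x => ?_)
  simp only [ContinuousMap.add_apply, ContinuousMap.smul_apply, smul_eq_mul]
  ring

theorem dualObjective_eq (hX : IsCompact S.X) (T : ℕ) (u : ℝ) (w : C(S.X, ℝ))
    (W : BoundedContinuousFunction (Fin n → ℝ) ℝ) (hW : ∀ x : S.X, W x = w x) :
    S.dualObjective T u w = (∫ x in S.X, W x) + T * u * volume.real S.X := by
  have : IsFiniteMeasure (volume.restrict S.X) := ⟨by simpa using hX.measure_lt_top⟩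
  unfold dualObjective
  simp only [← hW]
  rw [integral_subtype_comap hX.measurableSet (fun x => W x + T * u),
    integral_add (W.integrable _) (integrable_const _), setIntegral_const, smul_eq_mul,
    mul_comm (volume.real S.X)]

theorem dualObjective_nonneg {T : ℕ} {u : ℝ} {v w : C(S.X, ℝ)} (h : S.IsDualFeasible u v w) :
    0 ≤ S.dualObjective T u w :=
  integral_nonneg fun x => add_nonneg (h.w_nonneg x) (mul_nonneg T.cast_nonneg h.u_nonneg)

theorem isDualFeasible_const : S.IsDualFeasible 0 0 1 where
  init := by simp
  dominate := by simp
  w_nonneg := by simp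
  decrease := by simp
  u_nonneg := le_rfl

/-! ### The dual constraints as a single linear map -/

/-- The states of `X` whose successor lies in `X`. -/
def stay : Set (Fin n → ℝ) := S.X ∩ S.step ⁻¹' S.X

theorem isCompact_stay (hX : IsCompact S.X) : IsCompact S.stay :=
  hX.inter_right (hX.isClosed.preimage S.continuous_step)

/-- The inclusion of the initial set into the ambient set. -/
def inclInit (h0 : S.X0 ⊆ S.X) : C(S.X0, S.X) := ⟨Set.inclusion h0, continuous_inclusion h0⟩

/-- The inclusion of the staying set into the ambient set. -/
def inclStay : C(S.stay, S.X) :=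
  ⟨Set.inclusion Set.inter_subset_left, continuous_inclusion Set.inter_subset_left⟩

/-- The transition map from the staying set to the ambient set. -/
noncomputable def stepStay : C(S.stay, S.X) :=
  ⟨fun x => ⟨S.step x, x.2.2⟩, (S.continuous_step.comp continuous_subtype_val).subtype_mk _⟩

/-- The values of the dual constraints, homogenized by the variable `p`, at `(p, u, v, w)`. -/
noncomputable def constraintMap (h0 : S.X0 ⊆ S.X) :
    (ℝ × ℝ × C(S.X, ℝ) × C(S.X, ℝ)) →ₗ[ℝ]
      (C(S.X0, ℝ) × C(S.X, ℝ) × C(S.X, ℝ) × C(S.stay, ℝ) × ℝ) where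
  toFun z := (z.2.2.1.comp (S.inclInit h0), z.2.2.2 - z.2.2.1 - z.1 • 1, z.2.2.2,
    z.2.1 • 1 + z.2.2.1.comp S.stepStay - z.2.2.1.comp S.inclStay, z.2.1)
  map_add' y z := by
    refine Prod.ext ?_ (Prod.ext ?_ (Prod.ext ?_ (Prod.ext ?_ ?_)))
    · ext x; simp
    · ext x; simp; ring
    · ext x; simp
    · ext x; simp; ring
    · simp
  map_smul' c z := by
    refine Prod.ext ?_ (Prod.ext ?_ (Prod.ext ?_ (Prod.ext ?_ ?_)))
    · ext x; simp
    · ext x; simp; ring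
    · ext x; simp
    · ext x; simp; ring
    · simp

theorem constraintMap_nonneg_iff (h0 : S.X0 ⊆ S.X) (p u : ℝ) (v w : C(S.X, ℝ)) :
    0 ≤ S.constraintMap h0 (p, u, v, w) ↔
      (∀ x : S.X, (x : Fin n → ℝ) ∈ S.X0 → 0 ≤ v x) ∧ (∀ x : S.X, p + v x ≤ w x) ∧
      (∀ x : S.X, 0 ≤ w x) ∧
      (∀ (x : S.X) (hx : S.step x ∈ S.X), v x ≤ u + v ⟨S.step x, hx⟩) ∧ 0 ≤ u := by
  constructor
  · rintro ⟨h1, h2, h3, h4, h5⟩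
    refine ⟨fun x hx => h1 ⟨x, hx⟩, fun x => ?_, h3, fun x hx => ?_, h5⟩
    · have : 0 ≤ w x - v x - p * 1 := h2 x
      linarith
    · have : 0 ≤ u * 1 + v ⟨S.step x, hx⟩ - v x := h4 ⟨x, x.2, hx⟩
      linarith
  · rintro ⟨h1, h2, h3, h4, h5⟩
    refine ⟨fun x => h1 ⟨x, h0 x.2⟩ x.2, fun x => ?_, h3, fun x => ?_, h5⟩
    · change 0 ≤ w x - v x - p * 1
      linarith [h2 x]
    · change 0 ≤ u * 1 + v ⟨S.step x, x.2.2⟩ - v ⟨x, x.2.1⟩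
      linarith [h4 ⟨x, x.2.1⟩ x.2.2]

theorem isDualFeasible_iff (h0 : S.X0 ⊆ S.X) (u : ℝ) (v w : C(S.X, ℝ)) :
    S.IsDualFeasible u v w ↔ 0 ≤ S.constraintMap h0 (1, u, v, w) := by
  rw [constraintMap_nonneg_iff]
  exact ⟨fun h => ⟨h.1, h.2, h.3, h.4, h.5⟩, fun h => ⟨h.1, h.2.1, h.2.2.1, h.2.2.2.1, h.2.2.2.2⟩⟩

/-- Slater-type condition: this is the cofinality hypothesis of `exists_nonneg_comp_eq`, and it
replaces any closedness argument for the cone. -/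
theorem exists_le_constraintMap (h0 : S.X0 ⊆ S.X) (hX0 : IsCompact S.X0) (hX : IsCompact S.X)
    (e : C(S.X0, ℝ) × C(S.X, ℝ) × C(S.X, ℝ) × C(S.stay, ℝ) × ℝ) :
    ∃ z, e ≤ S.constraintMap h0 z := by
  have : CompactSpace S.X := isCompact_iff_compactSpace.mp hX
  have : CompactSpace S.X0 := isCompact_iff_compactSpace.mp hX0
  have : CompactSpace S.stay := isCompact_iff_compactSpace.mp (S.isCompact_stay hX)
  obtain ⟨e0, e1, e2, e3, e4⟩ := e
  obtain ⟨M, hM, h0M, h1M, h2M, h3M, h4M⟩ : ∃ M : ℝ, 0 ≤ M ∧ ‖e0‖ ≤ M ∧ ‖e1‖ ≤ M ∧ ‖e2‖ ≤ M ∧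
      ‖e3‖ ≤ M ∧ ‖e4‖ ≤ M := by
    refine ⟨‖e0‖ + ‖e1‖ + ‖e2‖ + ‖e3‖ + ‖e4‖, by positivity, ?_, ?_, ?_, ?_, ?_⟩ <;>
      linarith [norm_nonneg e0, norm_nonneg e1, norm_nonneg e2, norm_nonneg e3, norm_nonneg e4]
  have bound {Y : Type _} [TopologicalSpace Y] [CompactSpace Y] (f : C(Y, ℝ)) (hf : ‖f‖ ≤ M)
      (y : Y) : f y ≤ M := (le_abs_self _).trans ((f.norm_coe_le_norm y).trans hf)
  -- With p = 0, u = v = M and w = 2M, the five components are M, M, 2M, M, M.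
  refine ⟨(0, M, M • 1, (2 * M) • 1), ?_, ?_, ?_, ?_, ?_⟩
  · intro x
    change e0 x ≤ M * 1
    linarith [bound e0 h0M x]
  · intro x
    change e1 x ≤ 2 * M * 1 - M * 1 - 0 * 1
    linarith [bound e1 h1M x]
  · intro x
    change e2 x ≤ 2 * M * 1
    linarith [bound e2 h2M x]
  · intro x
    change e3 x ≤ M * 1 + M * 1 - M * 1
    linarith [bound e3 h3M x]
  · exact (le_abs_self _).trans h4M

/-- The homogenized dual objective, at `(p, u, v, w)`. -/
noncomputable def objectiveMap (hX : IsCompact S.X) (T : ℕ) (D : ℝ) :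
    (ℝ × ℝ × C(S.X, ℝ) × C(S.X, ℝ)) →ₗ[ℝ] ℝ where
  toFun z := S.dualObjective T z.2.1 z.2.2.2 - D * z.1
  map_add' y z := by
    have := S.dualObjective_combo hX T 1 1 y.2.1 z.2.1 y.2.2.2 z.2.2.2
    simp only [one_mul, one_smul] at this
    simp only [Prod.fst_add, Prod.snd_add, this]
    ring
  map_smul' c z := by
    have := S.dualObjective_combo hX T c 0 z.2.1 0 z.2.2.2 0
    simp only [zero_mul, zero_smul, add_zero] at this
    simp only [Prod.smul_fst, Prod.smul_snd, smul_eq_mul, RingHom.id_apply, this]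
    ring

/-- The variable p may have any sign. Adding N copies of a nearly optimal feasible point makes p + N
positive; dividing by it gives a feasible point, whose objective is at least D. The near-optimality
error, chosen as ε / N, contributes only ε. -/
theorem objectiveMap_nonneg (h0 : S.X0 ⊆ S.X) (hX : IsCompact S.X) (T : ℕ) (D : ℝ)
    (hD : ∀ u v w, S.IsDualFeasible u v w → D ≤ S.dualObjective T u w)
    (hD' : ∀ ε > 0, ∃ u v w, S.IsDualFeasible u v w ∧ S.dualObjective T u w < D + ε)
    (z : ℝ × ℝ × C(S.X, ℝ) × C(S.X, ℝ)) (hz : 0 ≤ S.constraintMap h0 z) :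
    0 ≤ S.objectiveMap hX T D z := by
  obtain ⟨p, u, v, w⟩ := z
  refine le_of_forall_pos_le_add fun ε hε => ?_
  obtain ⟨N, hN, hs⟩ : ∃ N : ℝ, 0 < N ∧ 0 < p + N :=
    ⟨|p| + 1, by positivity, by linarith [neg_abs_le p]⟩
  obtain ⟨u', v', w', hf, hlt⟩ := hD' (ε / N) (by positivity)
  rw [S.isDualFeasible_iff h0] at hf
  have hcone : 0 ≤ S.constraintMap h0
      ((p + N)⁻¹ • (p, u, v, w) + ((p + N)⁻¹ * N) • (1, u', v', w')) := by
    rw [map_add, map_smul, map_smul]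
    exact add_nonneg (smul_nonneg (by positivity) hz) (smul_nonneg (by positivity) hf)
  have hone : (p + N)⁻¹ * p + (p + N)⁻¹ * N * 1 = 1 := by
    field_simp
  have heq : (p + N)⁻¹ • (p, u, v, w) + ((p + N)⁻¹ * N) • ((1 : ℝ), u', v', w') =
      (1, (p + N)⁻¹ * u + (p + N)⁻¹ * N * u', (p + N)⁻¹ • v + ((p + N)⁻¹ * N) • v',
        (p + N)⁻¹ • w + ((p + N)⁻¹ * N) • w') := by
    simp only [Prod.smul_mk, Prod.mk_add_mk, smul_eq_mul, hone]
  rw [heq, ← S.isDualFeasible_iff h0] at hcone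
  have h1 := hD _ _ _ hcone
  rw [S.dualObjective_combo hX] at h1
  have h2 : D * (p + N) ≤ S.dualObjective T u w + N * S.dualObjective T u' w' := by
    have := mul_le_mul_of_nonneg_right h1 hs.le
    refine this.trans (le_of_eq ?_)
    field_simp
  have h3 : N * S.dualObjective T u' w' ≤ N * D + ε := by
    have := mul_le_mul_of_nonneg_left hlt.le hN.le
    rwa [mul_add, mul_div_cancel₀ _ hN.ne'] at this
  change 0 ≤ S.dualObjective T u w - D * p + ε
  linarith


/-! ### Weak duality -/

theorem IsMeasureOn.real_eq_univ {A : Set (Fin n → ℝ)} {μ : Measure (Fin n → ℝ)}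
    (h : IsMeasureOn A μ) : μ.real A = μ.real Set.univ :=
  measureReal_congr (ae_eq_univ.2 h.2)

theorem IsMeasureOn.ae_mem {A : Set (Fin n → ℝ)} {μ : Measure (Fin n → ℝ)}
    (h : IsMeasureOn A μ) : ∀ᵐ x ∂μ, x ∈ A :=
  mem_ae_iff.2 h.2

variable {S} in
-- The image measure of ν is dominated by μ + ν, which lives on X. Thus the restricted dual
-- constraint suffices ν-almost everywhere.
theorem IsPrimalFeasible.ae_step_mem {T : ℕ} {μ₀ μ μ' ν : Measure (Fin n → ℝ)} {a : ℝ}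
    (h : S.IsPrimalFeasible T μ₀ μ μ' ν a) (hX : IsCompact S.X) : ∀ᵐ x ∂ν, S.step x ∈ S.X := by
  have h1 : (μ + ν) S.Xᶜ = 0 := by simp [h.mu_mem.2, h.occ_mem.2]
  rw [h.liouville, Measure.add_apply, add_eq_zero,
    Measure.map_apply S.continuous_step.measurable hX.measurableSet.compl] at h1
  exact mem_ae_iff.2 h1.1

variable {S} in
theorem IsPrimalFeasible.real_le_dualObjective {T : ℕ} {μ₀ μ μ' ν : Measure (Fin n → ℝ)} {a : ℝ}
    (h : S.IsPrimalFeasible T μ₀ μ μ' ν a) (h0 : S.X0 ⊆ S.X) (hX : IsCompact S.X) {u : ℝ}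
    {v w : C(S.X, ℝ)} (hd : S.IsDualFeasible u v w) : μ.real S.X ≤ S.dualObjective T u w := by
  obtain ⟨V, hV⟩ := S.exists_bounded_extension hX v
  obtain ⟨W, hW⟩ := S.exists_bounded_extension hX w
  have := h.init_mem.1
  have := h.mu_mem.1
  have := h.slack_mem.1
  have := h.occ_mem.1
  have hstep := S.continuous_step
  let V' : BoundedContinuousFunction (Fin n → ℝ) ℝ := V.compContinuous ⟨S.step, hstep⟩
  have hV' : ∀ x, V' x = V (S.step x) := fun x => rfl
  have hmap : ∫ x, V x ∂(ν.map S.step) = ∫ x, V' x ∂ν :=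
    integral_map hstep.aemeasurable V.continuous.aestronglyMeasurable
  have : IsFiniteMeasure (ν.map S.step) := inferInstance
  have hl : ∫ x, V x ∂μ + ∫ x, V x ∂ν = ∫ x, V' x ∂ν + ∫ x, V x ∂μ₀ := by
    rw [← integral_add_measure (V.integrable _) (V.integrable _), h.liouville,
      integral_add_measure (V.integrable _) (V.integrable _), hmap]
  have hw : ∫ x in S.X, W x = ∫ x, W x ∂μ + ∫ x, W x ∂μ' := by
    rw [← h.domination, integral_add_measure (W.integrable _) (W.integrable _)]
  have e1 : μ.real S.X + ∫ x, V x ∂μ ≤ ∫ x, W x ∂μ := by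
    have : μ.real S.X + ∫ x, V x ∂μ = ∫ x, (1 + V x) ∂μ := by
      rw [integral_add (integrable_const _) (V.integrable _), integral_const, smul_eq_mul, mul_one,
        h.mu_mem.real_eq_univ]
    rw [this]
    refine integral_mono_ae ((integrable_const _).add (V.integrable _)) (W.integrable _) ?_
    filter_upwards [h.mu_mem.ae_mem] with x hx
    have := hd.dominate ⟨x, hx⟩
    rwa [← hV, ← hW] at this
  have e2 : 0 ≤ ∫ x, W x ∂μ' := by
    refine integral_nonneg_of_ae ?_
    filter_upwards [h.slack_mem.ae_mem] with x hx
    have := hd.w_nonneg ⟨x, hx⟩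
    rwa [← hW] at this
  have e3 : 0 ≤ ∫ x, V x ∂μ₀ := by
    refine integral_nonneg_of_ae ?_
    filter_upwards [h.init_mem.ae_mem] with x hx
    have := hd.init ⟨x, h0 hx⟩ hx
    rwa [← hV] at this
  have e4 : ∫ x, V x ∂ν ≤ u * ν.real S.X + ∫ x, V' x ∂ν := by
    have : u * ν.real S.X + ∫ x, V' x ∂ν = ∫ x, (u + V' x) ∂ν := by
      rw [integral_add (integrable_const _) (V'.integrable _), integral_const, smul_eq_mul,
        h.occ_mem.real_eq_univ, mul_comm]
    rw [this]
    refine integral_mono_ae (V.integrable _) ((integrable_const _).add (V'.integrable _)) ?_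
    filter_upwards [h.occ_mem.ae_mem, h.ae_step_mem hX] with x hx hx'
    have := hd.decrease ⟨x, hx⟩ hx'
    rwa [← hV, ← hV] at this
  -- The mass constraint with a ≥ 0 reads ν(X) ≤ T vol X.
  have e5 : u * ν.real S.X ≤ T * u * volume.real S.X := by
    have := mul_le_mul_of_nonneg_left (le_of_le_of_eq (le_add_of_nonneg_right h.a_nonneg) h.mass)
      hd.u_nonneg
    linarith
  rw [S.dualObjective_eq hX T u w W hW]
  linarith

/-! ### Strong duality -/

/-- Strong duality, with a primal optimal point. -/
theorem exists_isPrimalFeasible_real_eq (h0 : S.X0 ⊆ S.X) (hX0 : IsCompact S.X0)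
    (hX : IsCompact S.X) (T : ℕ) (D : ℝ)
    (hD : ∀ u v w, S.IsDualFeasible u v w → D ≤ S.dualObjective T u w)
    (hD' : ∀ ε > 0, ∃ u v w, S.IsDualFeasible u v w ∧ S.dualObjective T u w < D + ε) :
    ∃ (μ₀ μ μ' ν : Measure (Fin n → ℝ)) (a : ℝ),
      S.IsPrimalFeasible T μ₀ μ μ' ν a ∧ μ.real S.X = D := by
  obtain ⟨φ, hφ, hφL⟩ := exists_nonneg_comp_eq (S.constraintMap h0) (S.objectiveMap hX T D)
    (S.objectiveMap_nonneg h0 hX T D hD hD') (S.exists_le_constraintMap h0 hX0 hX)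
  have hstep := S.continuous_step
  let ι0 := LinearMap.inl ℝ C(S.X0, ℝ) (C(S.X, ℝ) × C(S.X, ℝ) × C(S.stay, ℝ) × ℝ)
  let ρ0 := LinearMap.inr ℝ C(S.X0, ℝ) (C(S.X, ℝ) × C(S.X, ℝ) × C(S.stay, ℝ) × ℝ)
  let ι1 := ρ0 ∘ₗ LinearMap.inl ℝ C(S.X, ℝ) (C(S.X, ℝ) × C(S.stay, ℝ) × ℝ)
  let ρ1 := ρ0 ∘ₗ LinearMap.inr ℝ C(S.X, ℝ) (C(S.X, ℝ) × C(S.stay, ℝ) × ℝ)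
  let ι2 := ρ1 ∘ₗ LinearMap.inl ℝ C(S.X, ℝ) (C(S.stay, ℝ) × ℝ)
  let ρ2 := ρ1 ∘ₗ LinearMap.inr ℝ C(S.X, ℝ) (C(S.stay, ℝ) × ℝ)
  let ι3 := ρ2 ∘ₗ LinearMap.inl ℝ C(S.stay, ℝ) ℝ
  let ι4 := ρ2 ∘ₗ LinearMap.inr ℝ C(S.stay, ℝ) ℝ
  have hsum : ∀ e0 e1 e2 e3 e4, φ (e0, e1, e2, e3, e4) =
      φ (ι0 e0) + φ (ι1 e1) + φ (ι2 e2) + φ (ι3 e3) + φ (ι4 e4) := by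
    intro e0 e1 e2 e3 e4
    simp only [← map_add]
    simp [ι0, ι1, ι2, ι3, ι4, ρ0, ρ1, ρ2]
  obtain ⟨μ₀, f0, z0, i0⟩ := exists_measure_of_isCompact hX0 (φ ∘ₗ ι0)
    (fun f hf => hφ _ ⟨hf, le_rfl, le_rfl, le_rfl, le_rfl⟩)
  obtain ⟨μ, f1, z1, i1⟩ := exists_measure_of_isCompact hX (φ ∘ₗ ι1)
    (fun f hf => hφ _ ⟨le_rfl, hf, le_rfl, le_rfl, le_rfl⟩)
  obtain ⟨μ', f2, z2, i2⟩ := exists_measure_of_isCompact hX (φ ∘ₗ ι2)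
    (fun f hf => hφ _ ⟨le_rfl, le_rfl, hf, le_rfl, le_rfl⟩)
  obtain ⟨ν, f3, z3, i3⟩ := exists_measure_of_isCompact (S.isCompact_stay hX) (φ ∘ₗ ι3)
    (fun f hf => hφ _ ⟨le_rfl, le_rfl, le_rfl, hf, le_rfl⟩)
  have ha : 0 ≤ φ (ι4 1) := hφ _ ⟨le_rfl, le_rfl, le_rfl, le_rfl, zero_le_one⟩
  have hfin : IsFiniteMeasure (volume.restrict S.X) := ⟨by simpa using hX.measure_lt_top⟩
  have z3' : ν S.Xᶜ = 0 :=
    measure_mono_null (Set.compl_subset_compl.2 Set.inter_subset_left) z3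
  have on0 : IsMeasureOn S.X0 μ₀ := ⟨f0, z0⟩
  have on1 : IsMeasureOn S.X μ := ⟨f1, z1⟩
  have on2 : IsMeasureOn S.X μ' := ⟨f2, z2⟩
  have on3 : IsMeasureOn S.X ν := ⟨f3, z3'⟩
  have hmass : μ.real S.X = φ (ι1 1) := by
    have := i1 1
    simp only [ContinuousMap.one_apply, integral_const, smul_eq_mul, mul_one] at this
    rw [on1.real_eq_univ, this]
    rfl
  have hnu : ν.real S.X = φ (ι3 1) := by
    have := i3 1
    simp only [ContinuousMap.one_apply, integral_const, smul_eq_mul, mul_one] at this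
    rw [on3.real_eq_univ, this]
    rfl
  -- Evaluating φ ∘ A = L along the variables u, v, w, p gives, in this order, the mass constraint,
  -- the transport equation, the domination constraint and the value D.
  refine ⟨μ₀, μ, μ', ν, φ (ι4 1), ⟨on0, on1, on2, on3, ha, ?_, ?_, ?_⟩, ?_⟩
  · have h := hφL (0, 1, 0, 0)
    have e : S.constraintMap h0 (0, 1, 0, 0) = (0, 0, 0, 1, 1) := by
      simp [constraintMap]
    have e' : S.objectiveMap hX T D (0, 1, 0, 0) = T * volume.real S.X := by
      change S.dualObjective T 1 0 - D * 0 = _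
      rw [S.dualObjective_eq hX T 1 0 0 (by simp)]
      simp
    rw [e, e', hsum] at h
    simpa [hnu] using h
  · have : IsFiniteMeasure (ν.map S.step) := inferInstance
    refine ext_of_forall_integral_eq_of_IsFiniteMeasure fun V => ?_
    have h := hφL (0, 0, V.toContinuousMap.restrict S.X, 0)
    have e : S.constraintMap h0 (0, 0, V.toContinuousMap.restrict S.X, 0) =
        (V.toContinuousMap.restrict S.X0, -V.toContinuousMap.restrict S.X, 0,
          (V.toContinuousMap.comp ⟨S.step, hstep⟩).restrict S.stay -
            V.toContinuousMap.restrict S.stay, 0) := by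
      refine Prod.ext ?_ (Prod.ext ?_ (Prod.ext ?_ (Prod.ext ?_ ?_)))
      · rfl
      · ext x; simp [constraintMap]
      · rfl
      · ext x; simp [constraintMap, stepStay, inclStay]; rfl
      · rfl
    have e' : S.objectiveMap hX T D (0, 0, V.toContinuousMap.restrict S.X, 0) = 0 := by
      change S.dualObjective T 0 0 - D * 0 = _
      rw [S.dualObjective_eq hX T 0 0 0 (by simp)]
      simp
    rw [e, e', hsum] at h
    simp only [map_neg, map_sub, map_zero, add_zero] at h
    have j0 : ∫ x, V x ∂μ₀ = φ (ι0 (V.toContinuousMap.restrict S.X0)) := i0 V.toContinuousMap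
    have j1 : ∫ x, V x ∂μ = φ (ι1 (V.toContinuousMap.restrict S.X)) := i1 V.toContinuousMap
    have j3 : ∫ x, V x ∂ν = φ (ι3 (V.toContinuousMap.restrict S.stay)) := i3 V.toContinuousMap
    have j3' : ∫ x, V x ∂(ν.map S.step) =
        φ (ι3 ((V.toContinuousMap.comp ⟨S.step, hstep⟩).restrict S.stay)) :=
      (integral_map hstep.aemeasurable V.continuous.aestronglyMeasurable).trans
        (i3 (V.toContinuousMap.comp ⟨S.step, hstep⟩))
    rw [integral_add_measure (V.integrable _) (V.integrable _),
      integral_add_measure (V.integrable _) (V.integrable _), j0, j1, j3, j3']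
    linarith
  · refine ext_of_forall_integral_eq_of_IsFiniteMeasure fun W => ?_
    have h := hφL (0, 0, 0, W.toContinuousMap.restrict S.X)
    have e : S.constraintMap h0 (0, 0, 0, W.toContinuousMap.restrict S.X) =
        (0, W.toContinuousMap.restrict S.X, W.toContinuousMap.restrict S.X, 0, 0) := by
      simp [constraintMap]
    have e' : S.objectiveMap hX T D (0, 0, 0, W.toContinuousMap.restrict S.X) =
        ∫ x in S.X, W x := by
      change S.dualObjective T 0 (W.toContinuousMap.restrict S.X) - D * 0 = _
      rw [S.dualObjective_eq hX T 0 _ W (fun x => rfl)]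
      simp
    rw [e, e', hsum] at h
    simp only [map_zero, add_zero, zero_add] at h
    rw [integral_add_measure (W.integrable _) (W.integrable _), ← h]
    exact congrArg₂ (· + ·) (i1 W.toContinuousMap) (i2 W.toContinuousMap)
  · have h := hφL (1, 0, 0, 0)
    have e : S.constraintMap h0 (1, 0, 0, 0) = (0, -1, 0, 0, 0) := by
      simp [constraintMap]
    have e' : S.objectiveMap hX T D (1, 0, 0, 0) = -D := by
      change S.dualObjective T 0 0 - D * 1 = _
      rw [S.dualObjective_eq hX T 0 0 0 (by simp)]
      simp
    rw [e, e', hsum] at h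
    simp only [map_zero, map_neg, add_zero, zero_add] at h
    linarith


/-! ### Reachable sets and first-arrival layers -/

theorem step_mem_reachUpTo {t : ℕ} {x : Fin n → ℝ} (hx : x ∈ S.reachUpTo t) :
    S.step x ∈ S.reachUpTo (t + 1) := by
  obtain ⟨s, hs, y, hy, rfl⟩ := hx
  exact ⟨s + 1, Nat.succ_le_succ hs, y, hy, Function.iterate_succ_apply' _ _ _⟩

theorem reachUpTo_mono : Monotone S.reachUpTo :=
  fun _ _ h _ ⟨r, hr, hx⟩ => ⟨r, hr.trans h, hx⟩

theorem step_mem_reachSet {x : Fin n → ℝ} (hx : x ∈ S.reachSet) : S.step x ∈ S.reachSet := by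
  obtain ⟨t, ht⟩ := Set.mem_iUnion.1 hx
  exact S.reachUpTo_subset_reachSet _ (S.step_mem_reachUpTo ht)

theorem step_mem_closure_reachSet {x : Fin n → ℝ} (hx : x ∈ closure S.reachSet) :
    S.step x ∈ closure S.reachSet :=
  (show Set.MapsTo S.step S.reachSet S.reachSet from fun _ => S.step_mem_reachSet).closure
    S.continuous_step hx

theorem isCompact_image_iterate (hX0 : IsCompact S.X0) (t : ℕ) :
    IsCompact (S.step^[t] '' S.X0) :=
  hX0.image (S.continuous_step.iterate t)

theorem measurableSet_reachUpTo (hX0 : IsCompact S.X0) (t : ℕ) :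
    MeasurableSet (S.reachUpTo t) := by
  have : S.reachUpTo t = ⋃ s ∈ Set.Iic t, S.step^[s] '' S.X0 := by
    ext x; simp [reachUpTo]
  rw [this]
  exact (((Set.finite_Iic t).isCompact_biUnion
    fun s _ => S.isCompact_image_iterate hX0 s)).measurableSet

theorem measurableSet_newStates (hX0 : IsCompact S.X0) : ∀ t, MeasurableSet (S.newStates t)
  | 0 => hX0.measurableSet
  | t + 1 => (S.isCompact_image_iterate hX0 (t + 1)).measurableSet.diff
      (S.measurableSet_reachUpTo hX0 t)

theorem newStates_subset_reachUpTo : ∀ t, S.newStates t ⊆ S.reachUpTo t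
  | 0 => S.X0_subset_reachUpTo 0
  | t + 1 => fun _ hx => ⟨t + 1, le_rfl, hx.1⟩

theorem disjoint_newStates_reachUpTo {s t : ℕ} (h : s < t) :
    Disjoint (S.newStates t) (S.reachUpTo s) := by
  obtain ⟨t, rfl⟩ := Nat.exists_eq_succ_of_ne_zero (Nat.ne_zero_of_lt h)
  exact Set.disjoint_sdiff_left.mono_right (S.reachUpTo_mono (Nat.lt_succ_iff.1 h))

theorem pairwise_disjoint_newStates : Pairwise (Function.onFun Disjoint S.newStates) :=
  (pairwise_disjoint_on S.newStates).2 fun s _ h =>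
    ((S.disjoint_newStates_reachUpTo h).mono_right (S.newStates_subset_reachUpTo s)).symm

/-- Write t as the number of s < t and exchange the sums: for fixed s, the layers Y^t with t > s are
disjoint subsets of X^∞ \ X^s. -/
theorem tsum_mul_volume_newStates_le (hX0 : IsCompact S.X0) :
    ∑' t : ℕ, (t : ℝ≥0∞) * volume (S.newStates t) ≤
      ∑' s : ℕ, volume (S.reachSet \ S.reachUpTo s) := by
  have h1 : ∀ t : ℕ, (t : ℝ≥0∞) * volume (S.newStates t) =
      ∑' s : ℕ, volume (if s < t then S.newStates t else ∅) := by
    intro t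
    rw [tsum_eq_sum (s := Finset.range t)]
    · rw [Finset.sum_congr rfl (g := fun _ => volume (S.newStates t))]
      · simp
      · intro s hs
        rw [if_pos (Finset.mem_range.1 hs)]
    · intro s hs
      rw [if_neg (by simpa using hs), measure_empty]
  simp_rw [h1]
  rw [ENNReal.tsum_comm]
  refine ENNReal.tsum_le_tsum fun s => ?_
  have hsub : ∀ t, (if s < t then S.newStates t else ∅) ⊆ S.newStates t := by
    intro t
    split_ifs
    exacts [subset_rfl, Set.empty_subset _]
  rw [← measure_iUnion]
  · refine measure_mono (Set.iUnion_subset fun t => ?_)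
    split_ifs with h
    · exact Set.subset_sdiff.2 ⟨(S.newStates_subset_reachUpTo t).trans
        (S.reachUpTo_subset_reachSet t), S.disjoint_newStates_reachUpTo h⟩
    · exact Set.empty_subset _
  · exact fun i j hij => (S.pairwise_disjoint_newStates hij).mono (hsub i) (hsub j)
  · intro t
    split_ifs
    exacts [S.measurableSet_newStates hX0 t, MeasurableSet.empty]

/-! ### Consequences of the transport equation -/

variable {S}

theorem IsPrimalFeasible.measure_add {T : ℕ} {μ₀ μ μ' ν : Measure (Fin n → ℝ)} {a : ℝ}
    (h : S.IsPrimalFeasible T μ₀ μ μ' ν a) {B : Set (Fin n → ℝ)} (hB : MeasurableSet B)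
    (hB0 : Disjoint S.X0 B) : μ B + ν B = ν (S.step ⁻¹' B) := by
  have h0 : μ₀ B = 0 := measure_mono_null hB0.subset_compl_left h.init_mem.2
  rw [← Measure.add_apply, h.liouville, Measure.add_apply,
    Measure.map_apply S.continuous_step.measurable hB, h0, add_zero]

/-- The closure of X^∞ is forward invariant, so the preimage of its complement B lies in B; then
μ(B) + ν(B) ≤ ν(B), and ν is finite. -/
theorem IsPrimalFeasible.measure_compl_closure {T : ℕ} {μ₀ μ μ' ν : Measure (Fin n → ℝ)} {a : ℝ}
    (h : S.IsPrimalFeasible T μ₀ μ μ' ν a) : μ (closure S.reachSet)ᶜ = 0 := by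
  have := h.occ_mem.1
  have h1 := h.measure_add (B := (closure S.reachSet)ᶜ) isClosed_closure.measurableSet.compl
    (Set.disjoint_compl_right_iff_subset.2 (S.X0_subset_reachSet.trans subset_closure))
  have h2 : ν (S.step ⁻¹' (closure S.reachSet)ᶜ) ≤ ν (closure S.reachSet)ᶜ :=
    measure_mono fun x hx hx' => hx (S.step_mem_closure_reachSet hx')
  rw [← h1] at h2
  refine nonpos_iff_eq_zero.1 ?_
  exact (ENNReal.add_le_add_iff_right (measure_ne_top ν (closure S.reachSet)ᶜ)).1 (by rwa [zero_add])

theorem IsPrimalFeasible.le_volume {T : ℕ} {μ₀ μ μ' ν : Measure (Fin n → ℝ)} {a : ℝ}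
    (h : S.IsPrimalFeasible T μ₀ μ μ' ν a) (B : Set (Fin n → ℝ)) : μ B ≤ volume B :=
  calc μ B ≤ (μ + μ') B := by simp
    _ = volume.restrict S.X B := by rw [h.domination]
    _ ≤ volume B := Measure.restrict_apply_le _ _

theorem IsPrimalFeasible.univ_le_volume_reachSet {T : ℕ} {μ₀ μ μ' ν : Measure (Fin n → ℝ)} {a : ℝ}
    (h : S.IsPrimalFeasible T μ₀ μ μ' ν a)
    (hclosure : volume S.reachSet = volume (closure S.reachSet)) :
    μ Set.univ ≤ volume S.reachSet := by
  rw [← measure_congr (ae_eq_univ.2 h.measure_compl_closure), hclosure]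
  exact h.le_volume _

/-- Let B_t be the complement of X^t. Since f maps X^t into X^(t+1), f⁻¹(B_(t+1)) ⊆ B_t, so
μ(B_(t+1)) + ν(B_(t+1)) ≤ ν(B_t), which telescopes. -/
theorem IsPrimalFeasible.sum_measure_compl_le {T : ℕ} {μ₀ μ μ' ν : Measure (Fin n → ℝ)} {a : ℝ}
    (h : S.IsPrimalFeasible T μ₀ μ μ' ν a) (hX0 : IsCompact S.X0) (N : ℕ) :
    ∑ s ∈ Finset.range (N + 1), μ (S.reachUpTo s)ᶜ + ν (S.reachUpTo N)ᶜ ≤ ν Set.univ := by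
  have key : ∀ t, μ (S.reachUpTo t)ᶜ + ν (S.reachUpTo t)ᶜ = ν (S.step ⁻¹' (S.reachUpTo t)ᶜ) :=
    fun t => h.measure_add (S.measurableSet_reachUpTo hX0 t).compl
      (Set.disjoint_compl_right_iff_subset.2 (S.X0_subset_reachUpTo t))
  induction N with
  | zero =>
    rw [Finset.sum_range_one, key]
    exact measure_mono (Set.subset_univ _)
  | succ N ih =>
    rw [Finset.sum_range_succ, add_assoc, key]
    refine le_trans (add_le_add_right (measure_mono ?_) _) ih
    exact fun x hx hx' => hx (S.step_mem_reachUpTo hx')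

/-- Full mass together with μ ≤ vol gives vol X^∞ − vol X^s ≤ μ(ℝⁿ) − μ(X^s), so the tails of X^∞
are bounded by the summable tails of μ. -/
theorem IsPrimalFeasible.finiteSum {T : ℕ} {μ₀ μ μ' ν : Measure (Fin n → ℝ)} {a : ℝ}
    (h : S.IsPrimalFeasible T μ₀ μ μ' ν a) (hX0 : IsCompact S.X0)
    (hvol : volume S.reachSet ≤ μ Set.univ) : S.FiniteSum := by
  have := h.mu_mem.1
  have := h.occ_mem.1
  refine lt_of_le_of_lt (S.tsum_mul_volume_newStates_le hX0) ?_
  refine lt_of_le_of_lt (b := ∑' s : ℕ, μ (S.reachUpTo s)ᶜ) ?_ ?_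
  · refine ENNReal.tsum_le_tsum fun s => ?_
    have hm := S.measurableSet_reachUpTo hX0 s
    have hfin : volume (S.reachUpTo s) ≠ ⊤ :=
      ne_top_of_le_ne_top (ne_top_of_le_ne_top (measure_ne_top μ _) hvol)
        (measure_mono (S.reachUpTo_subset_reachSet s))
    rw [measure_sdiff (S.reachUpTo_subset_reachSet s) hm.nullMeasurableSet hfin,
      measure_compl hm (measure_ne_top _ _)]
    exact tsub_le_tsub hvol (h.le_volume _)
  · refine lt_of_le_of_lt ?_ (measure_lt_top ν Set.univ)
    refine ENNReal.tsum_le_of_sum_range_le fun N => ?_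
    refine le_trans ?_ (h.sum_measure_compl_le hX0 N)
    rw [Finset.sum_range_succ]
    exact le_self_add.trans le_self_add

/-- With u = 0, v does not decrease along orbits, which stay in X; hence v ≥ 0 and w ≥ 1 on X^∞. -/
theorem IsDualFeasible.volume_reachSet_le {v w : C(S.X, ℝ)} (h : S.IsDualFeasible 0 v w)
    (hX : IsCompact S.X) (hX0 : IsCompact S.X0) (hreach : S.reachSet ⊆ S.X) (T : ℕ) :
    volume.real S.reachSet ≤ S.dualObjective T 0 w := by
  have hv : ∀ t (x : S.X), (x : Fin n → ℝ) ∈ S.step^[t] '' S.X0 → 0 ≤ v x := by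
    intro t
    induction t with
    | zero =>
      rintro ⟨_, _⟩ ⟨y, hy, rfl⟩
      exact h.init _ hy
    | succ t ih =>
      rintro ⟨_, hx⟩ ⟨y, hy, rfl⟩
      have hyX : S.step^[t] y ∈ S.X :=
        hreach (S.reachUpTo_subset_reachSet t ⟨t, le_rfl, y, hy, rfl⟩)
      have h1 := ih ⟨_, hyX⟩ ⟨y, hy, rfl⟩
      have hstep := Function.iterate_succ_apply' S.step t y
      have h2 := h.decrease ⟨_, hyX⟩ (by rw [← hstep]; exact hx)
      simp only [← hstep, zero_add] at h2
      exact h1.trans h2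
  obtain ⟨W, hW⟩ := S.exists_bounded_extension hX w
  have hm : MeasurableSet S.reachSet :=
    MeasurableSet.iUnion fun t => S.measurableSet_reachUpTo hX0 t
  have : IsFiniteMeasure (volume.restrict S.X) := ⟨by simpa using hX.measure_lt_top⟩
  rw [S.dualObjective_eq hX T 0 w W hW, mul_zero, zero_mul, add_zero]
  calc volume.real S.reachSet = ∫ x in S.reachSet, (1 : ℝ) := by simp
    _ ≤ ∫ x in S.reachSet, W x := by
      refine setIntegral_mono_on ?_ ?_ hm fun x hx => ?_
      · exact IntegrableOn.mono_set (integrable_const (μ := volume.restrict S.X) (1 : ℝ)) hreach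
      · exact IntegrableOn.mono_set (W.integrable (volume.restrict S.X)) hreach
      · obtain ⟨t, s, -, hs⟩ := Set.mem_iUnion.1 hx
        rw [hW ⟨x, hreach hx⟩]
        linarith [hv s ⟨x, hreach hx⟩ hs, h.dominate ⟨x, hreach hx⟩]
    _ ≤ ∫ x in S.X, W x := by
      refine setIntegral_mono_set (W.integrable _) ?_ hreach.eventuallyLE
      refine (ae_restrict_iff' hX.measurableSet).2 (Eventually.of_forall fun x hx => ?_)
      change 0 ≤ W x
      rw [hW ⟨x, hx⟩]
      exact h.w_nonneg _

/-! ### Optimal values and minimizing sequences -/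

variable (S)

theorem exists_dualValue_eq (T : ℕ) : ∃ D : ℝ, S.dualValue T = D := by
  have h0 : 0 ≤ S.dualValue T := by
    refine le_sInf ?_
    rintro _ ⟨u, v, w, h, rfl⟩
    exact_mod_cast S.dualObjective_nonneg h
  have h1 : S.dualValue T ≤ (S.dualObjective T 0 1 : ℝ) :=
    sInf_le ⟨0, 0, 1, S.isDualFeasible_const, rfl⟩
  refine ⟨(S.dualValue T).toReal, (EReal.coe_toReal ?_ ?_).symm⟩
  · exact ne_top_of_le_ne_top (EReal.coe_ne_top _) h1
  · exact ne_bot_of_le_ne_bot (by simp) h0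

theorem exists_isDualMinimizingSeq (T : ℕ) :
    ∃ (u : ℕ → ℝ) (v w : ℕ → C(S.X, ℝ)), S.IsDualMinimizingSeq T u v w := by
  obtain ⟨r, -, hr, hmem⟩ := exists_seq_tendsto_sInf
    (S := {r : EReal | ∃ (u : ℝ) (v w : C(S.X, ℝ)),
      S.IsDualFeasible u v w ∧ r = ((S.dualObjective T u w : ℝ) : EReal)})
    ⟨_, 0, 0, 1, S.isDualFeasible_const, rfl⟩ (OrderBot.bddBelow _)
  choose u v w h hrw using hmem
  refine ⟨u, v, w, h, ?_⟩
  simp only [← hrw]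
  exact hr

theorem exists_isPrimalFeasible_eq_dualValue (h0 : S.X0 ⊆ S.X) (hX0 : IsCompact S.X0)
    (hX : IsCompact S.X) (T : ℕ) :
    ∃ (μ₀ μ μ' ν : Measure (Fin n → ℝ)) (a : ℝ),
      S.IsPrimalFeasible T μ₀ μ μ' ν a ∧ ((μ.real S.X : ℝ) : EReal) = S.dualValue T := by
  obtain ⟨D, hD⟩ := S.exists_dualValue_eq T
  obtain ⟨μ₀, μ, μ', ν, a, h, hμ⟩ := S.exists_isPrimalFeasible_real_eq h0 hX0 hX T D
    (fun u v w h => by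
      have : S.dualValue T ≤ (S.dualObjective T u w : ℝ) := sInf_le ⟨u, v, w, h, rfl⟩
      rw [hD] at this
      exact_mod_cast this)
    (fun ε hε => by
      have : S.dualValue T < ((D + ε : ℝ) : EReal) := by
        rw [hD]
        exact_mod_cast lt_add_of_pos_right D hε
      obtain ⟨_, ⟨u, v, w, h, rfl⟩, hlt⟩ := sInf_lt_iff.1 this
      exact ⟨u, v, w, h, by exact_mod_cast hlt⟩)
  exact ⟨μ₀, μ, μ', ν, a, h, by rw [hμ, hD]⟩

theorem primalValue_eq_dualValue (h0 : S.X0 ⊆ S.X) (hX0 : IsCompact S.X0)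
    (hX : IsCompact S.X) (T : ℕ) : S.primalValue T = S.dualValue T := by
  refine le_antisymm (sSup_le ?_) ?_
  · rintro _ ⟨μ₀, μ, μ', ν, a, h, rfl⟩
    refine le_sInf ?_
    rintro _ ⟨u, v, w, hd, rfl⟩
    exact_mod_cast h.real_le_dualObjective h0 hX hd
  · obtain ⟨μ₀, μ, μ', ν, a, h, hμ⟩ := S.exists_isPrimalFeasible_eq_dualValue h0 hX0 hX T
    exact le_sSup ⟨μ₀, μ, μ', ν, a, h, hμ.symm⟩

/-- A minimizing sequence with `u = 0` infinitely often forces the finiteness of the series and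
identifies the dual value. -/
theorem finiteSum_and_dualValue_eq (hX0 : IsCompact S.X0) (hX : IsCompact S.X)
    (hreach : S.reachSet ⊆ S.X) (hclosure : volume S.reachSet = volume (closure S.reachSet))
    {T : ℕ} {u : ℕ → ℝ} {v w : ℕ → C(S.X, ℝ)} (hseq : S.IsDualMinimizingSeq T u v w)
    (hu : ∃ᶠ k in atTop, u k = 0) :
    S.FiniteSum ∧ S.dualValue T = ((volume S.reachSet : ℝ≥0∞) : EReal) := by
  have hfin : volume S.reachSet ≠ ⊤ :=
    ne_top_of_le_ne_top hX.measure_ne_top (measure_mono hreach)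
  obtain ⟨μ₀, μ, μ', ν, a, h, hμ⟩ := S.exists_isPrimalFeasible_eq_dualValue
    (S.X0_subset_reachSet.trans hreach) hX0 hX T
  have := h.mu_mem.1
  have hle : ((volume S.reachSet : ℝ≥0∞) : EReal) ≤ S.dualValue T := by
    -- A lower bound on the objective that holds for infinitely many k passes to the limit.
    refine ge_of_tendsto_of_frequently hseq.2 (hu.mono fun k hk => ?_)
    have hf := hseq.1 k
    rw [hk] at hf ⊢
    have := hf.volume_reachSet_le hX hX0 hreach T
    rw [← EReal.coe_ennreal_toReal hfin]
    exact_mod_cast this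
  have heq : ((μ Set.univ : ℝ≥0∞) : EReal) = S.dualValue T := by
    rw [← hμ, h.mu_mem.real_eq_univ, ← EReal.coe_ennreal_toReal (measure_ne_top _ _)]
    rfl
  rw [← heq, EReal.coe_ennreal_le_coe_ennreal_iff] at hle
  refine ⟨h.finiteSum hX0 hle, ?_⟩
  rw [← heq, le_antisymm (h.univ_le_volume_reachSet hclosure) hle]

end PolySystem

theorem mainTheorem3 {n : ℕ} (S : PolySystem n)
    (hX0 : IsCompact S.X0) (hX : IsCompact S.X)
    (hreach : S.reachSet ⊆ S.X)
    (hclosure : volume S.reachSet = volume (closure S.reachSet))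
    (T : ℕ) (hT : 1 ≤ T) :
    S.primalValue T = S.dualValue T ∧
    (∃ r : ℝ, S.dualValue T = (r : EReal)) ∧
    (∃ (u : ℕ → ℝ) (v w : ℕ → C(S.X, ℝ)), S.IsDualMinimizingSeq T u v w) ∧
    (∀ (u : ℝ) (v w : C(S.X, ℝ)), S.IsDualMinimizer T u v w → u = 0 →
      S.FiniteSum ∧
      S.primalValue T = ((volume S.reachSet : ℝ≥0∞) : EReal) ∧
      S.dualValue T = ((volume S.reachSet : ℝ≥0∞) : EReal)) ∧
    (∀ (u : ℕ → ℝ) (v w : ℕ → C(S.X, ℝ)), S.IsDualMinimizingSeq T u v w →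
      (∃ᶠ k in atTop, u k = 0) →
      S.FiniteSum ∧
      S.primalValue T = ((volume S.reachSet : ℝ≥0∞) : EReal) ∧
      S.dualValue T = ((volume S.reachSet : ℝ≥0∞) : EReal)) := by
  have h0 : S.X0 ⊆ S.X := S.X0_subset_reachSet.trans hreach
  have hpd := S.primalValue_eq_dualValue h0 hX0 hX T
  have key : ∀ (u : ℕ → ℝ) (v w : ℕ → C(S.X, ℝ)), S.IsDualMinimizingSeq T u v w →
      (∃ᶠ k in atTop, u k = 0) →
      S.FiniteSum ∧
      S.primalValue T = ((volume S.reachSet : ℝ≥0∞) : EReal) ∧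
      S.dualValue T = ((volume S.reachSet : ℝ≥0∞) : EReal) := by
    intro u v w hseq hu
    obtain ⟨h1, h2⟩ := S.finiteSum_and_dualValue_eq hX0 hX hreach hclosure hseq hu
    exact ⟨h1, hpd.trans h2, h2⟩
  refine ⟨hpd, S.exists_dualValue_eq T, S.exists_isDualMinimizingSeq T, fun u v w h hu => ?_, key⟩
  -- A minimizer is a constant minimizing sequence.
  refine key (fun _ => u) (fun _ => v) (fun _ => w) ⟨fun _ => h.1, ?_⟩
    (Eventually.of_forall fun _ => hu).frequently
  simp only [h.2]
  exact tendsto_const_nhds
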